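/- Let $T>0$ and write $L^p=L^p(0,1)$; the index $\varepsilon$ runs over $(0,1]$. A net $(f_\varepsilon)$ in a normed space $X$ is called $X$-moderate if there are $N\in\mathbb N_0$ and $C$ with $\|f_\varepsilon\|_X\le C\varepsilon^{-N}$ for all $\varepsilon\in(0,1]$, and $X$-negligible if for every $k\in\mathbb N$ there is $C_k$ with $\|f_\varepsilon\|_X\le C_k\varepsilon^{k}$ for all $\varepsilon\in(0,1]$. A net $(f_\varepsilon)$ in $L^2$ whose distributional second derivatives $f_\varepsilon''$ belong to $L^2$ is called $H^2$-moderate, respectively $H^2$-negligible, if the same estimates hold for $\|f_\varepsilon\|_{L^2}+\|f_\varepsilon''\|_{L^2}$. For real-valued $q\in L^\infty$ let $\mathcal L_q=-\partial_x^2+q$ with Dirichlet boundary conditions on $(0,1)$. For real-valued $a,b,q\in L^\infty$ and complex-valued $u_0,u_1\in L^2$, a solution of $$\partial_t^2u+\mathcal L_{q}u+a(x)u+b(x)\partial_tu=0\ \text{ in }[0,T]\times(0,1),\qquad u(0,\cdot)=u_0,\quad \partial_tu(0,\cdot)=u_1,\qquad u(t,0)=u(t,1)=0 \qquad (P)$$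 is a function $u\in C([0,T];H^1_0(0,1))\cap C^1([0,T];L^2(0,1))$ that takes the initial values and satisfies the equation in the sense of distributions: for every $\varphi\in C_c^\infty(0,1)$ and $t\in[0,T]$, $$\frac{d}{dt}\int_0^1\partial_tu\,\varphi\,dx=-\int_0^1\big(\partial_xu\,\varphi'+q\,u\,\varphi+a\,u\,\varphi+b\,\partial_tu\,\varphi\big)dx .$$ Theorem (uniqueness of the very weak solution for $s=1$). Let $(a_\varepsilon),(\tilde a_\varepsilon),(b_\varepsilon),(\tilde b_\varepsilon)$ be $L^\infty$-moderate nets of non-negative functions and $(q_\varepsilon),(\tilde q_\varepsilon)$ be $L^\infty$-moderate nets of real-valued functions such that the operators $\mathcal L_{q_\varepsilon}$ are bounded below uniformly in $\varepsilon$, that is, there is $\Lambda\in\mathbb R$ with $$\int_0^1|f'|^2+q_\varepsilon|f|^2\,dx\ \ge\ -\Lambda\int_0^1|f|^2\,dx\qquad\text{for all } f\in H^1_0(0,1),\ \varepsilon\in(0,1]$$ (for instance $q_\varepsilon\ge0$ for all $\varepsilon$, or all Dirichlet eigenvalues of all $\mathcal L_{q_\varepsilon}$ positive). Let $(u_{0,\varepsilon}),(\tilde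 u_{0,\varepsilon})$ be $H^2$-moderate and $(u_{1,\varepsilon}),(\tilde u_{1,\varepsilon})$ be $L^2$-moderate. Suppose that $(a_\varepsilon-\tilde a_\varepsilon)$, $(b_\varepsilon-\tilde b_\varepsilon)$ and $(q_\varepsilon-\tilde q_\varepsilon)$ are $L^\infty$-negligible, that $(u_{0,\varepsilon}-\tilde u_{0,\varepsilon})$ is $H^2$-negligible and that $(u_{1,\varepsilon}-\tilde u_{1,\varepsilon})$ is $L^2$-negligible. Suppose that for every $\varepsilon\in(0,1]$ the function $u_\varepsilon$ is a solution of $(P)$ with the coefficients $a_\varepsilon,b_\varepsilon,q_\varepsilon$ and the data $u_{0,\varepsilon},u_{1,\varepsilon}$, and $\tilde u_\varepsilon$ is a solution of $(P)$ with $\tilde a_\varepsilon,\tilde b_\varepsilon,\tilde q_\varepsilon$ and $\tilde u_{0,\varepsilon},\tilde u_{1,\varepsilon}$. Then $(u_\varepsilon-\tilde u_\varepsilon)$ is $L^2$-negligible, uniformly in $t$: for every $k\in\mathbb N$ there is $C_k$ with $$\|u_\varepsilon(t,\cdot)-\tilde u_\varepsilon(t,\cdot)\|_{L^2}\le C_k\,\varepsilon^k\qquad\text{for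 all }\varepsilon\in(0,1],\ t\in[0,T].$$ In particular this holds when the nets are regularisations of distributions $a,b,q,u_0,u_1\in\mathcal D'(0,1)$, that is, the problem with these distributions as coefficients and data has a unique very weak solution. -/

import Mathlib

open MeasureTheory Set
open scoped ENNReal ContDiff

namespace VeryWeakWave

noncomputable section

/-- Lebesgue measure on the interval `(0,1)`. -/
abbrev mu : Measure ℝ := volume.restrict (Ioo (0 : ℝ) 1)

/-- The space `L²(0,1)` of complex-valued functions. -/
abbrev L2 : Type := Lp ℂ 2 mu

/-- The space `L^∞(0,1)` of real-valued functions; its order is the almost everywhere order. -/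
abbrev Linfty : Type := Lp ℝ ∞ mu

/-- Test functions: `φ ∈ C_c^∞((0,1))`. -/
structure IsTest (φ : ℝ → ℂ) : Prop where
  smooth : ContDiff ℝ ∞ φ
  compact : HasCompactSupport φ
  support : tsupport φ ⊆ Ioo (0 : ℝ) 1

/-- `f'' = h` on `(0,1)` in the sense of distributions. -/
def HasWeakSecondDeriv (f h : L2) : Prop :=
  ∀ φ : ℝ → ℂ, IsTest φ → ∫ x, f x * deriv (deriv φ) x ∂mu = ∫ x, h x * φ x ∂mu

/-- `f ∈ H¹₀(0,1)` with derivative `g ∈ L²(0,1)`: the function `f` has the absolutely continuous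
representative `x ↦ ∫_0^x g`, and this representative vanishes at `0` and at `1`. -/
structure HasH10Deriv (f g : L2) : Prop where
  ae_eq : ∀ᵐ x ∂mu, f x = ∫ y in (0 : ℝ)..x, g y
  boundary : ∫ y in (0 : ℝ)..1, g y = 0

/-- A net indexed by `ε ∈ (0,1]` in a normed space `X` is `X`-moderate. -/
def Moderate {X : Type*} [NormedAddCommGroup X] (f : ℝ → X) : Prop :=
  ∃ N : ℕ, ∃ C : ℝ, ∀ ε ∈ Ioc (0 : ℝ) 1, ‖f ε‖ ≤ C * (ε ^ N)⁻¹

/-- A net indexed by `ε ∈ (0,1]` in a normed space `X` is `X`-negligible. -/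
def Negligible {X : Type*} [NormedAddCommGroup X] (f : ℝ → X) : Prop :=
  ∀ k : ℕ, ∃ C : ℝ, ∀ ε ∈ Ioc (0 : ℝ) 1, ‖f ε‖ ≤ C * ε ^ k

/-- The net `f` is `H²`-moderate: `f_ε, f_ε'' ∈ L²` and `‖f_ε‖ + ‖f_ε''‖ ≤ C ε^{-N}`. -/
def H2Moderate (f : ℝ → L2) : Prop :=
  ∃ h : ℝ → L2, (∀ ε ∈ Ioc (0 : ℝ) 1, HasWeakSecondDeriv (f ε) (h ε)) ∧
    ∃ N : ℕ, ∃ C : ℝ, ∀ ε ∈ Ioc (0 : ℝ) 1, ‖f ε‖ + ‖h ε‖ ≤ C * (ε ^ N)⁻¹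

/-- The net `f` is `H²`-negligible: `f_ε, f_ε'' ∈ L²` and `‖f_ε‖ + ‖f_ε''‖ ≤ C_k ε^k` for all
`k`. -/
def H2Negligible (f : ℝ → L2) : Prop :=
  ∃ h : ℝ → L2, (∀ ε ∈ Ioc (0 : ℝ) 1, HasWeakSecondDeriv (f ε) (h ε)) ∧
    ∀ k : ℕ, ∃ C : ℝ, ∀ ε ∈ Ioc (0 : ℝ) 1, ‖f ε‖ + ‖h ε‖ ≤ C * ε ^ k

/-- The net `u` of functions of `t ∈ [0,T]` with values in `L²(0,1)` is `L²`-negligible, with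
constants that do not depend on `t`. -/
def L2NegligibleOn (T : ℝ) (u : ℝ → ℝ → L2) : Prop :=
  ∀ k : ℕ, ∃ C : ℝ, ∀ ε ∈ Ioc (0 : ℝ) 1, ∀ t ∈ Icc (0 : ℝ) T, ‖u ε t‖ ≤ C * ε ^ k

/-- The Sturm-Liouville operator `L_q = -d²/dx² + q` with Dirichlet boundary conditions is bounded
below by `-Λ`, that is `∫ |f'|² + q |f|² ≥ -Λ ∫ |f|²` on the form domain `H¹₀(0,1)`. -/
def SturmLiouvilleBoundedBelow (q : Linfty) (Λ : ℝ) : Prop :=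
  ∀ f g : L2, HasH10Deriv f g →
    -Λ * ∫ x, ‖f x‖ ^ 2 ∂mu ≤ (∫ x, ‖g x‖ ^ 2 ∂mu) + ∫ x, q x * ‖f x‖ ^ 2 ∂mu

/-- `u` is a solution on `[0,T] × (0,1)` of
`u_tt - u_xx + q u + a u + b u_t = 0`, `u(0) = u₀`, `u_t(0) = u₁`, `u(t,0) = u(t,1) = 0`,
in the class `C([0,T]; H¹₀(0,1)) ∩ C¹([0,T]; L²(0,1))`; the equation holds in the sense of
distributions on `(0,1)`, tested with functions of `x`. -/
def IsSolution (T : ℝ) (a b q : Linfty) (u₀ u₁ : L2) (u : ℝ → L2) : Prop :=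
  ∃ ut ux : ℝ → L2,
    (∀ t ∈ Icc (0 : ℝ) T, HasH10Deriv (u t) (ux t)) ∧
    ContinuousOn ux (Icc 0 T) ∧
    (∀ t ∈ Icc (0 : ℝ) T, HasDerivWithinAt u (ut t) (Icc 0 T) t) ∧
    ContinuousOn ut (Icc 0 T) ∧
    u 0 = u₀ ∧ ut 0 = u₁ ∧
    ∀ φ : ℝ → ℂ, IsTest φ → ∀ t ∈ Icc (0 : ℝ) T,
      HasDerivWithinAt (fun s => ∫ x, ut s x * φ x ∂mu)
        (-((∫ x, ux t x * deriv φ x ∂mu) + (∫ x, (q x : ℂ) * u t x * φ x ∂mu)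
          + (∫ x, (a x : ℂ) * u t x * φ x ∂mu) + ∫ x, (b x : ℂ) * ut t x * φ x ∂mu))
        (Icc 0 T) t

end

end VeryWeakWave

open VeryWeakWave

/-!
Integrate the equation once in time. Elements of `H¹₀(0,1)` may then be tested with, in particular
`u(t)` itself, and the energy `‖u‖² + ‖∂ₓU‖² + ⟨U, (q + a) U⟩` with `U(t) = ∫₀ᵗ u` controls
`‖u(t)‖` by the `L²` norms of the data and of the source, with a constant that depends on the
coefficients only through the lower bounds of `L_q + a` and of `b`. The difference of two solutions
solves the integrated equation of one of them, with a source that is a sum of products of a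
negligible net (a difference of coefficients or data) and a moderate one (a coefficient, or the
other solution, which the same estimate bounds). Such products are negligible.
-/

namespace VeryWeakWave

noncomputable section

open scoped InnerProductSpace

section Nets

variable {X : Type*} [NormedAddCommGroup X] {A : Type*} [NormedRing A]

theorem Moderate.norm {f : ℝ → X} (hf : Moderate f) : Moderate (fun ε => ‖f ε‖) := by
  simpa only [Moderate, norm_norm] using hf

theorem Negligible.norm {f : ℝ → X} (hf : Negligible f) : Negligible (fun ε => ‖f ε‖) := by
  simpa only [Negligible, norm_norm] using hf

theorem Negligible.sub_rev {f g : ℝ → X} (h : Negligible (fun ε => f ε - g ε)) :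
    Negligible (fun ε => g ε - f ε) := by
  simpa only [Negligible, norm_sub_rev] using h

theorem moderate_const (x : X) : Moderate (fun _ => x) :=
  ⟨0, ‖x‖, fun _ _ => by simp⟩

theorem Negligible.moderate {f : ℝ → X} (hf : Negligible f) : Moderate f :=
  ⟨0, by simpa using hf 0⟩

theorem Moderate.add {f g : ℝ → X} (hf : Moderate f) (hg : Moderate g) :
    Moderate (fun ε => f ε + g ε) := by
  obtain ⟨N, C, hC⟩ := hf
  obtain ⟨M, D, hD⟩ := hg
  have inv_pow_le {m n : ℕ} (hmn : m ≤ n) {c ε : ℝ} (hε : ε ∈ Ioc (0 : ℝ) 1) :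
      c * (ε ^ m)⁻¹ ≤ |c| * (ε ^ n)⁻¹ :=
    mul_le_mul (le_abs_self c)
      (inv_anti₀ (pow_pos hε.1 n) (pow_le_pow_of_le_one hε.1.le hε.2 hmn))
      (inv_nonneg.2 (pow_nonneg hε.1.le m)) (abs_nonneg c)
  refine ⟨N + M, |C| + |D|, fun ε hε => ?_⟩
  calc ‖f ε + g ε‖ ≤ ‖f ε‖ + ‖g ε‖ := norm_add_le _ _
    _ ≤ C * (ε ^ N)⁻¹ + D * (ε ^ M)⁻¹ := add_le_add (hC ε hε) (hD ε hε)
    _ ≤ |C| * (ε ^ (N + M))⁻¹ + |D| * (ε ^ (N + M))⁻¹ :=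
        add_le_add (inv_pow_le (Nat.le_add_right N M) hε) (inv_pow_le (Nat.le_add_left M N) hε)
    _ = (|C| + |D|) * (ε ^ (N + M))⁻¹ := (add_mul _ _ _).symm

theorem Moderate.mul {f g : ℝ → A} (hf : Moderate f) (hg : Moderate g) :
    Moderate (fun ε => f ε * g ε) := by
  obtain ⟨N, C, hC⟩ := hf
  obtain ⟨M, D, hD⟩ := hg
  refine ⟨N + M, C * D, fun ε hε => ?_⟩
  calc ‖f ε * g ε‖ ≤ ‖f ε‖ * ‖g ε‖ := norm_mul_le _ _
    _ ≤ (C * (ε ^ N)⁻¹) * (D * (ε ^ M)⁻¹) := mul_le_mul (hC ε hε) (hD ε hε) (norm_nonneg _)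
        ((norm_nonneg _).trans (hC ε hε))
    _ = C * D * (ε ^ (N + M))⁻¹ := by rw [pow_add, mul_inv]; ring

theorem Negligible.add {f g : ℝ → X} (hf : Negligible f) (hg : Negligible g) :
    Negligible (fun ε => f ε + g ε) := by
  intro k
  obtain ⟨C, hC⟩ := hf k
  obtain ⟨D, hD⟩ := hg k
  refine ⟨C + D, fun ε hε => (norm_add_le _ _).trans ?_⟩
  rw [add_mul]
  exact add_le_add (hC ε hε) (hD ε hε)

theorem Moderate.mul_negligible {f g : ℝ → A} (hf : Moderate f) (hg : Negligible g) :
    Negligible (fun ε => f ε * g ε) := by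
  intro k
  obtain ⟨N, C, hC⟩ := hf
  obtain ⟨D, hD⟩ := hg (N + k)
  refine ⟨C * D, fun ε hε => ?_⟩
  have hεN : ε ^ N ≠ 0 := (pow_pos hε.1 N).ne'
  calc ‖f ε * g ε‖ ≤ ‖f ε‖ * ‖g ε‖ := norm_mul_le _ _
    _ ≤ (C * (ε ^ N)⁻¹) * (D * ε ^ (N + k)) := mul_le_mul (hC ε hε) (hD ε hε) (norm_nonneg _)
        ((norm_nonneg _).trans (hC ε hε))
    _ = C * D * ε ^ k := by rw [pow_add]; field_simp

theorem H2Moderate.moderate {f : ℝ → L2} (hf : H2Moderate f) : Moderate f := by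
  obtain ⟨h, -, N, C, hC⟩ := hf
  exact ⟨N, C, fun ε hε => (le_add_of_nonneg_right (norm_nonneg (h ε))).trans (hC ε hε)⟩

theorem H2Negligible.negligible {f : ℝ → L2} (hf : H2Negligible f) : Negligible f := by
  obtain ⟨h, -, hC⟩ := hf
  exact fun k => (hC k).imp fun _ hC ε hε =>
    (le_add_of_nonneg_right (norm_nonneg (h ε))).trans (hC ε hε)

end Nets

section Multiplication

variable {α : Type*} [MeasurableSpace α] {μ : Measure α} {p : ℝ≥0∞} [Fact (1 ≤ p)]

section NormedSpace

variable {E : Type*} [NormedAddCommGroup E] [NormedSpace ℝ E]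

/-- The operator on `L^p` of multiplication by a real `L^∞` function, depending linearly on that
function. -/
def mulOp : Lp ℝ ∞ μ →L[ℝ] Lp E p μ →L[ℝ] Lp E p μ :=
  (ContinuousLinearMap.lsmul ℝ ℝ : ℝ →L[ℝ] E →L[ℝ] E).holderL μ ∞ p p

theorem coeFn_mulOp (c : Lp ℝ ∞ μ) (f : Lp E p μ) : mulOp c f =ᵐ[μ] fun x => c x • f x :=
  (ContinuousLinearMap.lsmul ℝ ℝ : ℝ →L[ℝ] E →L[ℝ] E).coeFn_holder c f

theorem norm_mulOp_apply_le (c : Lp ℝ ∞ μ) (f : Lp E p μ) : ‖mulOp c f‖ ≤ ‖c‖ * ‖f‖ :=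
  calc ‖mulOp c f‖ ≤ ‖(ContinuousLinearMap.lsmul ℝ ℝ : ℝ →L[ℝ] E →L[ℝ] E)‖ * ‖c‖ * ‖f‖ :=
        ContinuousLinearMap.norm_holder_apply_apply_le _ c f
    _ ≤ 1 * ‖c‖ * ‖f‖ := by gcongr; exact ContinuousLinearMap.opNorm_lsmul_le
    _ = ‖c‖ * ‖f‖ := by rw [one_mul]

theorem norm_mulOp_le (c : Lp ℝ ∞ μ) : ‖(mulOp c : Lp E p μ →L[ℝ] Lp E p μ)‖ ≤ ‖c‖ :=
  ContinuousLinearMap.opNorm_le_bound _ (norm_nonneg c) (norm_mulOp_apply_le c)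

end NormedSpace

variable {E : Type*} [NormedAddCommGroup E] [InnerProductSpace ℝ E]

theorem norm_sq_eq_integral_norm_sq (f : Lp E 2 μ) : ‖f‖ ^ 2 = ∫ x, ‖f x‖ ^ 2 ∂μ := by
  simp only [← real_inner_self_eq_norm_sq, L2.inner_def]

theorem inner_mulOp_left (c : Lp ℝ ∞ μ) (f g : Lp E 2 μ) : ⟪mulOp c f, g⟫_ℝ = ⟪f, mulOp c g⟫_ℝ := by
  rw [L2.inner_def, L2.inner_def]
  refine integral_congr_ae ?_
  filter_upwards [coeFn_mulOp c f, coeFn_mulOp c g] with x hf hg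
  rw [hf, hg, real_inner_smul_left, real_inner_smul_right]

theorem inner_mulOp_self (c : Lp ℝ ∞ μ) (f : Lp E 2 μ) :
    ⟪f, mulOp c f⟫_ℝ = ∫ x, c x * ‖f x‖ ^ 2 ∂μ := by
  rw [L2.inner_def]
  refine integral_congr_ae ?_
  filter_upwards [coeFn_mulOp c f] with x hx
  rw [hx, real_inner_smul_right, real_inner_self_eq_norm_sq]

theorem neg_mul_norm_sq_le_inner_mulOp_self {c : Lp ℝ ∞ μ} {β : ℝ} (hc : ∀ᵐ x ∂μ, -β ≤ c x)
    (f : Lp E 2 μ) : -β * ‖f‖ ^ 2 ≤ ⟪f, mulOp c f⟫_ℝ := by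
  rw [norm_sq_eq_integral_norm_sq, ← integral_const_mul, L2.inner_def]
  refine integral_mono_ae ?_ (L2.integrable_inner f _) ?_
  · simpa only [real_inner_self_eq_norm_sq] using (L2.integrable_inner (𝕜 := ℝ) f f).const_mul (-β)
  · filter_upwards [coeFn_mulOp c f, hc] with x hx hcx
    rw [hx, real_inner_smul_right, real_inner_self_eq_norm_sq]
    exact mul_le_mul_of_nonneg_right hcx (sq_nonneg _)

theorem inner_mulOp_self_nonneg {c : Lp ℝ ∞ μ} (hc : 0 ≤ c) (f : Lp E 2 μ) :
    0 ≤ ⟪f, mulOp c f⟫_ℝ := by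
  have hc_ae : ∀ᵐ x ∂μ, -0 ≤ c x :=
    ((Lp.coeFn_nonneg c).2 hc).mono fun _ hx => neg_zero.trans_le hx
  simpa using neg_mul_norm_sq_le_inner_mulOp_self hc_ae f

theorem inner_mulOp_self_le_add (c c' : Lp ℝ ∞ μ) (f : Lp E 2 μ) :
    ⟪f, mulOp c f⟫_ℝ ≤ ⟪f, mulOp c' f⟫_ℝ + ‖c - c'‖ * ‖f‖ ^ 2 := by
  have hsub : ⟪f, mulOp (c - c') f⟫_ℝ ≤ ‖c - c'‖ * ‖f‖ ^ 2 :=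
    calc ⟪f, mulOp (c - c') f⟫_ℝ ≤ ‖f‖ * ‖mulOp (c - c') f‖ := real_inner_le_norm _ _
      _ ≤ ‖f‖ * (‖c - c'‖ * ‖f‖) := by
        gcongr
        exact norm_mulOp_apply_le _ f
      _ = ‖c - c'‖ * ‖f‖ ^ 2 := by ring
  simp only [map_sub, sub_apply, inner_sub_right] at hsub
  linarith

end Multiplication

section Calculus

variable {E : Type*} [NormedAddCommGroup E]

theorem intervalIntegrable_of_continuousOn_Icc {f : ℝ → E} {a b t : ℝ}
    (hf : ContinuousOn f (Icc a b)) (ht : t ∈ Icc a b) : IntervalIntegrable f volume a t :=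
  (hf.mono (uIcc_subset_Icc (left_mem_Icc.2 (ht.1.trans ht.2)) ht)).intervalIntegrable

variable [NormedSpace ℝ E] [CompleteSpace E]

theorem hasDerivWithinAt_intervalIntegral_Icc {f : ℝ → E} {a b t : ℝ}
    (hf : ContinuousOn f (Icc a b)) (ht : t ∈ Icc a b) :
    HasDerivWithinAt (fun s => ∫ r in a..s, f r) (f t) (Icc a b) t := by
  have := Fact.mk ht
  exact intervalIntegral.integral_hasDerivWithinAt_right
    (intervalIntegrable_of_continuousOn_Icc hf ht)
    (hf.stronglyMeasurableAtFilter_nhdsWithin measurableSet_Icc t) (hf t ht)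

theorem intervalIntegral_mem {V : Submodule ℝ E} (hV : IsClosed (V : Set E))
    {f : ℝ → E} {a b : ℝ} (hf : ∀ t ∈ uIcc a b, f t ∈ V) : ∫ t in a..b, f t ∈ V := by
  by_cases hint : IntervalIntegrable f volume a b
  · rw [← Submodule.Quotient.mk_eq_zero]
    calc V.mkQL (∫ t in a..b, f t) = ∫ t in a..b, V.mkQL (f t) :=
          (ContinuousLinearMap.intervalIntegral_comp_comm _ hint).symm
      _ = ∫ _ in a..b, 0 := intervalIntegral.integral_congr fun t ht =>
          (Submodule.Quotient.mk_eq_zero V).2 (hf t ht)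
      _ = 0 := intervalIntegral.integral_zero
  · rw [intervalIntegral.integral_undef hint]
    exact V.zero_mem

theorem le_mul_exp_of_deriv_le_mul {f f' : ℝ → ℝ} {K a b : ℝ}
    (hf : ∀ t ∈ Icc a b, HasDerivWithinAt f (f' t) (Icc a b) t)
    (hf' : ∀ t ∈ Ico a b, f' t ≤ K * f t) :
    ∀ t ∈ Icc a b, f t ≤ f a * Real.exp (K * (t - a)) := by
  intro t ht
  rw [← gronwallBound_ε0]
  refine le_gronwallBound_of_liminf_deriv_right_le (f' := f')
    (fun s hs => (hf s hs).continuousWithinAt) (fun s hs r hr => ?_) le_rfl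
    (fun s hs => by simpa using hf' s hs) t ht
  exact ((hf s (Ico_subset_Icc_self hs)).mono_of_mem_nhdsWithin
    (Icc_mem_nhdsGE_of_mem hs)).liminf_right_slope_le hr

end Calculus

section Energy

variable {H G : Type*} [NormedAddCommGroup H] [InnerProductSpace ℝ H] [NormedAddCommGroup G]

theorem two_mul_real_inner_le (x y : H) : 2 * ⟪x, y⟫_ℝ ≤ ‖x‖ ^ 2 + ‖y‖ ^ 2 := by
  linarith [norm_sub_sq_real x y, sq_nonneg ‖x - y‖]

/-- The energy of the wave equation integrated in time: `U` is the time integral of the solution `v`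
and `W` the time integral of its space derivative. The shift `κ` makes up for a form
`‖W‖² + ⟪U, C U⟫` that is only bounded below. -/
def energy (C : H →L[ℝ] H) (κ : ℝ) (v U : H) (W : G) : ℝ :=
  ‖v‖ ^ 2 + ‖W‖ ^ 2 + ⟪U, C U⟫_ℝ + κ * ‖U‖ ^ 2

theorem norm_sq_add_norm_sq_le_energy {C : H →L[ℝ] H} {Λ κ : ℝ} (hκ : Λ + 1 ≤ κ) (v : H) {U : H}
    {W : G} (h : -Λ * ‖U‖ ^ 2 ≤ ‖W‖ ^ 2 + ⟪U, C U⟫_ℝ) :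
    ‖v‖ ^ 2 + ‖U‖ ^ 2 ≤ energy C κ v U W := by
  have hshift := mul_le_mul_of_nonneg_right hκ (sq_nonneg ‖U‖)
  rw [energy]
  linarith

variable [InnerProductSpace ℝ G]

theorem hasDerivWithinAt_energy {C : H →L[ℝ] H} (hC : (C : H →ₗ[ℝ] H).IsSymmetric) (κ : ℝ)
    {v U : ℝ → H} {W : ℝ → G} {v' U' : H} {W' : G} {s : Set ℝ} {t : ℝ}
    (hv : HasDerivWithinAt v v' s t) (hU : HasDerivWithinAt U U' s t)
    (hW : HasDerivWithinAt W W' s t) :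
    HasDerivWithinAt (fun t => energy C κ (v t) (U t) (W t))
      (2 * (⟪v t, v'⟫_ℝ + ⟪W t, W'⟫_ℝ + ⟪U', C (U t)⟫_ℝ + κ * ⟪U t, U'⟫_ℝ)) s t := by
  have hCU : HasDerivWithinAt (fun t => C (U t)) (C U') s t :=
    C.hasFDerivAt.comp_hasDerivWithinAt t hU
  have hsymm : ⟪U t, C U'⟫_ℝ = ⟪U', C (U t)⟫_ℝ := (hC (U t) U').symm.trans (real_inner_comm _ _)
  refine (((hv.norm_sq.add hW.norm_sq).add (hU.inner ℝ hCU)).add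
    (hU.norm_sq.const_mul κ)).congr_deriv ?_
  rw [hsymm]
  ring

/-- `v` is a weak solution of the abstract wave equation `v'' + A v + B v' + C v = F'` integrated in
time, where `A` is the operator of the form `⟪w, w⟫` on `V`: an element of `V` is a pair of a state
and its space derivative, and `w` is the space derivative of `v`. -/
structure IsIntegratedSolution (V : Submodule ℝ (H × G)) (T : ℝ) (B C : H →L[ℝ] H)
    (F v v' : ℝ → H) (w : ℝ → G) : Prop where
  mem : ∀ t ∈ Icc 0 T, (v t, w t) ∈ V
  hasDerivWithinAt : ∀ t ∈ Icc 0 T, HasDerivWithinAt v (v' t) (Icc 0 T) t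
  continuousOn_snd : ContinuousOn w (Icc 0 T)
  weak_eq : ∀ t ∈ Icc 0 T, ∀ p ∈ V,
    ⟪p.1, v' t + B (v t) + C (∫ s in (0 : ℝ)..t, v s) - F t⟫_ℝ
      + ⟪p.2, ∫ s in (0 : ℝ)..t, w s⟫_ℝ = 0

namespace IsIntegratedSolution

variable {V : Submodule ℝ (H × G)} {T : ℝ} {B C B' C' : H →L[ℝ] H}
  {F F' v v' z z' : ℝ → H} {w y : ℝ → G}

theorem continuousOn (h : IsIntegratedSolution V T B C F v v' w) : ContinuousOn v (Icc 0 T) :=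
  fun t ht => (h.hasDerivWithinAt t ht).continuousWithinAt

theorem sub (hv : IsIntegratedSolution V T B C F v v' w)
    (hz : IsIntegratedSolution V T B' C' F' z z' y) :
    IsIntegratedSolution V T B C
      (fun t => F t - F' t - ((C - C') (∫ s in (0 : ℝ)..t, z s) + (B - B') (z t)))
      (fun t => v t - z t) (fun t => v' t - z' t) (fun t => w t - y t) where
  mem t ht := V.sub_mem (hv.mem t ht) (hz.mem t ht)
  hasDerivWithinAt t ht := (hv.hasDerivWithinAt t ht).sub (hz.hasDerivWithinAt t ht)
  continuousOn_snd := hv.continuousOn_snd.sub hz.continuousOn_snd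
  weak_eq t ht p hp := by
    have ev := hv.weak_eq t ht p hp
    have ez := hz.weak_eq t ht p hp
    rw [intervalIntegral.integral_sub (intervalIntegrable_of_continuousOn_Icc hv.continuousOn ht)
        (intervalIntegrable_of_continuousOn_Icc hz.continuousOn ht),
      intervalIntegral.integral_sub
        (intervalIntegrable_of_continuousOn_Icc hv.continuousOn_snd ht)
        (intervalIntegrable_of_continuousOn_Icc hz.continuousOn_snd ht)]
    simp only [map_sub, sub_apply, inner_add_right, inner_sub_right] at ev ez ⊢
    linarith

variable [CompleteSpace H] [CompleteSpace G]

theorem integral_mem (hV : IsClosed (V : Set (H × G)))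
    (h : IsIntegratedSolution V T B C F v v' w) {t : ℝ} (ht : t ∈ Icc 0 T) :
    (∫ s in (0 : ℝ)..t, v s, ∫ s in (0 : ℝ)..t, w s) ∈ V := by
  have hint : IntervalIntegrable (fun s => (v s, w s)) volume 0 t :=
    intervalIntegrable_of_continuousOn_Icc (h.continuousOn.prodMk h.continuousOn_snd) ht
  have hfst := (ContinuousLinearMap.fst ℝ H G).intervalIntegral_comp_comm hint
  have hsnd := (ContinuousLinearMap.snd ℝ H G).intervalIntegral_comp_comm hint
  have hmem : ∫ s in (0 : ℝ)..t, (v s, w s) ∈ V := intervalIntegral_mem hV fun s hs =>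
    h.mem s (uIcc_subset_Icc (left_mem_Icc.2 (ht.1.trans ht.2)) ht hs)
  convert hmem using 1
  exact Prod.ext hfst hsnd

/-- Testing with `(v t, w t)` itself cancels every term of the derivative of the energy except those
of `B`, `F` and the shift. -/
theorem hasDerivWithinAt_energy (hC : (C : H →ₗ[ℝ] H).IsSymmetric)
    (h : IsIntegratedSolution V T B C F v v' w) (κ : ℝ) {t : ℝ} (ht : t ∈ Icc 0 T) :
    HasDerivWithinAt
      (fun t => energy C κ (v t) (∫ s in (0 : ℝ)..t, v s) (∫ s in (0 : ℝ)..t, w s))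
      (2 * (⟪v t, F t⟫_ℝ - ⟪v t, B (v t)⟫_ℝ + κ * ⟪∫ s in (0 : ℝ)..t, v s, v t⟫_ℝ))
      (Icc 0 T) t := by
  refine (VeryWeakWave.hasDerivWithinAt_energy hC κ (h.hasDerivWithinAt t ht)
    (hasDerivWithinAt_intervalIntegral_Icc h.continuousOn ht)
    (hasDerivWithinAt_intervalIntegral_Icc h.continuousOn_snd ht)).congr_deriv ?_
  have htest := h.weak_eq t ht _ (h.mem t ht)
  simp only [inner_add_right, inner_sub_right] at htest
  rw [real_inner_comm (w t)]
  linarith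

theorem energy_le {Λ β D : ℝ} (hV : IsClosed (V : Set (H × G)))
    (hC : (C : H →ₗ[ℝ] H).IsSymmetric)
    (hcoer : ∀ p ∈ V, -Λ * ‖p.1‖ ^ 2 ≤ ‖p.2‖ ^ 2 + ⟪p.1, C p.1⟫_ℝ)
    (hB : ∀ x, -β * ‖x‖ ^ 2 ≤ ⟪x, B x⟫_ℝ)
    (h : IsIntegratedSolution V T B C F v v' w) (hF : ∀ t ∈ Icc 0 T, ‖F t‖ ≤ D) :
    ∀ t ∈ Icc 0 T,
      energy C (|Λ| + 1) (v t) (∫ s in (0 : ℝ)..t, v s) (∫ s in (0 : ℝ)..t, w s) + D ^ 2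
        ≤ (‖v 0‖ ^ 2 + D ^ 2) * Real.exp ((|Λ| + 2 * |β| + 2) * t) := by
  have hgronwall := le_mul_exp_of_deriv_le_mul (K := |Λ| + 2 * |β| + 2)
    (fun t ht => (h.hasDerivWithinAt_energy hC (|Λ| + 1) ht).add_const (D ^ 2)) fun t ht => ?_
  · simpa [energy] using hgronwall
  replace ht := Ico_subset_Icc_self ht
  set U := ∫ s in (0 : ℝ)..t, v s
  have hlower := norm_sq_add_norm_sq_le_energy (add_le_add_left (le_abs_self Λ) 1) (v t)
    (hcoer _ (h.integral_mem hV ht))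
  have hsource : 2 * ⟪v t, F t⟫_ℝ ≤ ‖v t‖ ^ 2 + D ^ 2 :=
    (two_mul_real_inner_le _ _).trans (by gcongr; exact hF t ht)
  have hdamp : -(|β| * ‖v t‖ ^ 2) ≤ ⟪v t, B (v t)⟫_ℝ := by
    refine le_trans ?_ (hB (v t))
    rw [← neg_mul]
    gcongr
    exact le_abs_self β
  have hshift : (|Λ| + 1) * (2 * ⟪U, v t⟫_ℝ) ≤ (|Λ| + 1) * (‖U‖ ^ 2 + ‖v t‖ ^ 2) := by
    gcongr
    exact two_mul_real_inner_le _ _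
  calc 2 * (⟪v t, F t⟫_ℝ - ⟪v t, B (v t)⟫_ℝ + (|Λ| + 1) * ⟪U, v t⟫_ℝ)
      ≤ ‖v t‖ ^ 2 + D ^ 2 + 2 * |β| * ‖v t‖ ^ 2 + (|Λ| + 1) * (‖U‖ ^ 2 + ‖v t‖ ^ 2) := by
        linarith
    _ ≤ (|Λ| + 2 * |β| + 2) * (‖v t‖ ^ 2 + ‖U‖ ^ 2 + D ^ 2) := by
        have hΛD : 0 ≤ (|Λ| + 1) * D ^ 2 := by positivity
        have hβ : 0 ≤ |β| * (‖U‖ ^ 2 + D ^ 2) := by positivity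
        nlinarith [sq_nonneg ‖U‖]
    _ ≤ _ := by gcongr

theorem norm_le {Λ β D : ℝ} (hV : IsClosed (V : Set (H × G)))
    (hC : (C : H →ₗ[ℝ] H).IsSymmetric)
    (hcoer : ∀ p ∈ V, -Λ * ‖p.1‖ ^ 2 ≤ ‖p.2‖ ^ 2 + ⟪p.1, C p.1⟫_ℝ)
    (hB : ∀ x, -β * ‖x‖ ^ 2 ≤ ⟪x, B x⟫_ℝ)
    (h : IsIntegratedSolution V T B C F v v' w) (hF : ∀ t ∈ Icc 0 T, ‖F t‖ ≤ D) :
    ∀ t ∈ Icc 0 T, ‖v t‖ ≤ Real.exp ((|Λ| + 2 * |β| + 2) * T) * (‖v 0‖ + D) := by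
  intro t ht
  have hT : 0 ≤ T := ht.1.trans ht.2
  have hD : 0 ≤ D := (norm_nonneg _).trans (hF t ht)
  have hlower := norm_sq_add_norm_sq_le_energy (add_le_add_left (le_abs_self Λ) 1) (v t)
    (hcoer _ (h.integral_mem hV ht))
  have hexp : 1 ≤ Real.exp ((|Λ| + 2 * |β| + 2) * T) := Real.one_le_exp (by positivity)
  refine le_of_sq_le_sq ?_ (by positivity)
  calc ‖v t‖ ^ 2
      ≤ energy C (|Λ| + 1) (v t) (∫ s in (0 : ℝ)..t, v s) (∫ s in (0 : ℝ)..t, w s) + D ^ 2 := by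
        linarith [sq_nonneg D, sq_nonneg ‖∫ s in (0 : ℝ)..t, v s‖]
    _ ≤ (‖v 0‖ ^ 2 + D ^ 2) * Real.exp ((|Λ| + 2 * |β| + 2) * t) :=
        h.energy_le hV hC hcoer hB hF t ht
    _ ≤ (‖v 0‖ + D) ^ 2 * Real.exp ((|Λ| + 2 * |β| + 2) * T) ^ 2 := by
        gcongr
        · nlinarith [mul_nonneg (norm_nonneg (v 0)) hD]
        · refine le_trans ?_ (le_self_pow₀ hexp two_ne_zero)
          gcongr
          exact ht.2
    _ = (Real.exp ((|Λ| + 2 * |β| + 2) * T) * (‖v 0‖ + D)) ^ 2 := by rw [mul_comm, mul_pow]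

theorem norm_sub_le {Λ β δ M : ℝ} (hV : IsClosed (V : Set (H × G)))
    (hC : (C : H →ₗ[ℝ] H).IsSymmetric)
    (hcoer : ∀ p ∈ V, -Λ * ‖p.1‖ ^ 2 ≤ ‖p.2‖ ^ 2 + ⟪p.1, C p.1⟫_ℝ)
    (hB : ∀ x, -β * ‖x‖ ^ 2 ≤ ⟪x, B x⟫_ℝ)
    (hv : IsIntegratedSolution V T B C F v v' w)
    (hz : IsIntegratedSolution V T B' C' F' z z' y)
    (hF : ∀ t ∈ Icc 0 T, ‖F t - F' t‖ ≤ δ) (hM : ∀ t ∈ Icc 0 T, ‖z t‖ ≤ M) :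
    ∀ t ∈ Icc 0 T, ‖v t - z t‖ ≤ Real.exp ((|Λ| + 2 * |β| + 2) * T)
      * (‖v 0 - z 0‖ + (δ + M * (T * ‖C - C'‖ + ‖B - B'‖))) := by
  refine (hv.sub hz).norm_le hV hC hcoer hB fun t ht => ?_
  have hM0 : 0 ≤ M := (norm_nonneg _).trans (hM t ht)
  have hint : ‖∫ s in (0 : ℝ)..t, z s‖ ≤ T * M :=
    calc ‖∫ s in (0 : ℝ)..t, z s‖ ≤ M * |t - 0| :=
          intervalIntegral.norm_integral_le_of_norm_le_const fun s hs =>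
            hM s (uIcc_subset_Icc (left_mem_Icc.2 (ht.1.trans ht.2)) ht (uIoc_subset_uIcc hs))
      _ ≤ T * M := by
          rw [sub_zero, abs_of_nonneg ht.1, mul_comm]
          exact mul_le_mul_of_nonneg_right ht.2 hM0
  calc ‖F t - F' t - ((C - C') (∫ s in (0 : ℝ)..t, z s) + (B - B') (z t))‖
      ≤ ‖F t - F' t‖ + (‖(C - C') (∫ s in (0 : ℝ)..t, z s)‖ + ‖(B - B') (z t)‖) :=
        (_root_.norm_sub_le _ _).trans (add_le_add_right (norm_add_le _ _) _)
    _ ≤ δ + (‖C - C'‖ * (T * M) + ‖B - B'‖ * M) := by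
        gcongr
        · exact hF t ht
        · exact (C - C').le_opNorm_of_le hint
        · exact (B - B').le_opNorm_of_le (hM t ht)
    _ = δ + M * (T * ‖C - C'‖ + ‖B - B'‖) := by ring

end IsIntegratedSolution

end Energy

section SobolevSpace

instance : IsProbabilityMeasure mu := ⟨by simp [mu]⟩

theorem real_inner_eq_re_inner (f g : L2) : ⟪f, g⟫_ℝ = (⟪f, g⟫_ℂ).re := by
  rw [L2.inner_def, L2.inner_def]
  exact integral_re (L2.integrable_inner f g)

theorem ae_mu_mem_Icc : ∀ᵐ x ∂mu, x ∈ Icc (0 : ℝ) 1 :=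
  (ae_restrict_mem measurableSet_Ioo).mono fun _ hx => Ioo_subset_Icc_self hx

theorem intervalIntegral_mu {E : Type*} [NormedAddCommGroup E] [NormedSpace ℝ E] (f : ℝ → E)
    {x : ℝ} (hx : x ∈ Icc (0 : ℝ) 1) :
    ∫ y in (0 : ℝ)..x, f y ∂mu = ∫ y in (0 : ℝ)..x, f y := by
  rw [intervalIntegral.integral_of_le hx.1, intervalIntegral.integral_of_le hx.1,
    integral_Ioc_eq_integral_Ioo, integral_Ioc_eq_integral_Ioo,
    Measure.restrict_restrict_of_subset (Ioo_subset_Ioo_right hx.2)]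

theorem intervalIntegral_congr_mu {E : Type*} [NormedAddCommGroup E] [NormedSpace ℝ E]
    {f g : ℝ → E} (h : f =ᵐ[mu] g) {x : ℝ} (hx : x ∈ Icc (0 : ℝ) 1) :
    ∫ y in (0 : ℝ)..x, f y = ∫ y in (0 : ℝ)..x, g y := by
  rw [← intervalIntegral_mu f hx, ← intervalIntegral_mu g hx,
    intervalIntegral.integral_of_le hx.1, intervalIntegral.integral_of_le hx.1]
  exact integral_congr_ae (ae_restrict_of_ae h)

/-- The indicator function of `(0,x]` in `L²(0,1)`, which represents the primitive at `x` as an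
inner product. -/
def indicatorIoc (x : ℝ) : L2 :=
  indicatorConstLp 2 (measurableSet_Ioc : MeasurableSet (Ioc 0 x)) (measure_ne_top mu _) 1

theorem norm_indicatorIoc_le (x : ℝ) : ‖indicatorIoc x‖ ≤ 1 :=
  norm_indicatorConstLp_le.trans <| by
    rw [norm_one, one_mul]
    exact Real.rpow_le_one measureReal_nonneg measureReal_le_one (by positivity)

theorem inner_indicatorIoc (g : L2) {x : ℝ} (hx : x ∈ Icc (0 : ℝ) 1) :
    ⟪indicatorIoc x, g⟫_ℂ = ∫ y in (0 : ℝ)..x, g y := by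
  rw [indicatorIoc, L2.inner_indicatorConstLp_one, ← intervalIntegral_mu g hx,
    intervalIntegral.integral_of_le hx.1]

theorem norm_inner_indicatorIoc_le (g : L2) (x : ℝ) : ‖⟪indicatorIoc x, g⟫_ℂ‖ ≤ ‖g‖ :=
  (norm_inner_le_norm _ _).trans
    (mul_le_of_le_one_left (norm_nonneg g) (norm_indicatorIoc_le x))

theorem memLp_inner_indicatorIoc (g : L2) : MemLp (fun x => ⟪indicatorIoc x, g⟫_ℂ) 2 mu := by
  have hg : Integrable g mu := (Lp.memLp g).integrable one_le_two
  have hcont : Continuous fun x => ∫ y in (0 : ℝ)..x, g y ∂mu :=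
    intervalIntegral.continuous_primitive (fun _ _ => hg.intervalIntegrable) 0
  refine .of_bound (hcont.aestronglyMeasurable.congr ?_) ‖g‖
    (.of_forall (norm_inner_indicatorIoc_le g))
  filter_upwards [ae_mu_mem_Icc] with x hx
  rw [intervalIntegral_mu g hx, inner_indicatorIoc g hx]

/-- The Volterra operator `g ↦ (x ↦ ∫_0^x g)` on `L²(0,1)`. -/
def primitive : L2 →L[ℂ] L2 :=
  LinearMap.mkContinuous
    { toFun := fun g => (memLp_inner_indicatorIoc g).toLp
      map_add' := fun f g => by
        simp only [inner_add_right]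
        exact MemLp.toLp_add (memLp_inner_indicatorIoc f) (memLp_inner_indicatorIoc g)
      map_smul' := fun c g => by
        simp only [inner_smul_right]
        exact MemLp.toLp_const_smul c (memLp_inner_indicatorIoc g) }
    1 fun g => by
      have hbound : ∀ᵐ x ∂mu, ‖(memLp_inner_indicatorIoc g).toLp _ x‖ ≤ ‖g‖ := by
        filter_upwards [(memLp_inner_indicatorIoc g).coeFn_toLp] with x hx
        exact hx ▸ norm_inner_indicatorIoc_le g x
      simpa [measureUnivNNReal] using Lp.norm_le_of_ae_bound (norm_nonneg g) hbound

theorem coeFn_primitive (g : L2) : primitive g =ᵐ[mu] fun x => ∫ y in (0 : ℝ)..x, g y := by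
  filter_upwards [(memLp_inner_indicatorIoc g).coeFn_toLp, ae_mu_mem_Icc] with x hx hmem
  rw [← inner_indicatorIoc g hmem]
  exact hx

theorem hasH10Deriv_iff {f g : L2} :
    HasH10Deriv f g ↔ f = primitive g ∧ ⟪indicatorIoc 1, g⟫_ℂ = 0 := by
  rw [inner_indicatorIoc g (right_mem_Icc.2 zero_le_one)]
  constructor
  · rintro ⟨hf, hg⟩
    exact ⟨Lp.ext (Filter.EventuallyEq.trans hf (coeFn_primitive g).symm), hg⟩
  · rintro ⟨rfl, hg⟩
    exact ⟨coeFn_primitive g, hg⟩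

/-- The space `H¹₀(0,1)`, encoded as the graph of the derivative: the pairs of a function and its
derivative, as a subspace of `L² × L²`. -/
def h10Graph : Submodule ℝ (L2 × L2) :=
  ((ContinuousLinearMap.fst ℂ L2 L2 - primitive ∘L ContinuousLinearMap.snd ℂ L2 L2).prod
    (innerSL ℂ (indicatorIoc 1) ∘L ContinuousLinearMap.snd ℂ L2 L2)).ker.restrictScalars ℝ

theorem mem_h10Graph {p : L2 × L2} : p ∈ h10Graph ↔ HasH10Deriv p.1 p.2 := by
  simp [h10Graph, hasH10Deriv_iff, sub_eq_zero]

theorem isClosed_h10Graph : IsClosed (h10Graph : Set (L2 × L2)) :=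
  ContinuousLinearMap.isClosed_ker _

end SobolevSpace

section PrimitiveSupport

theorem support_primitive_subset_Icc {E : Type*} [NormedAddCommGroup E] [NormedSpace ℝ E]
    {f : ℝ → E} {a b α β : ℝ} (hα : a < α) (hβ : β < b) (hf : Function.support f ⊆ Icc α β)
    (hzero : ∫ y in a..b, f y = 0) :
    Function.support (fun x => ∫ y in a..x, f y) ⊆ Icc α β := by
  intro x hx
  refine ⟨le_of_not_gt fun hxα => hx ?_, le_of_not_gt fun hβx => hx ?_⟩
  · refine (intervalIntegral.integral_congr fun y hy => ?_).trans intervalIntegral.integral_zero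
    by_contra hy0
    exact ((hf hy0).1.trans hy.2).not_gt (max_lt hα hxα)
  · have hsub {c : ℝ} (hc : β < c) : Function.support f ⊆ Ioc a c :=
      hf.trans fun y hy => ⟨hα.trans_le hy.1, hy.2.trans hc.le⟩
    calc ∫ y in a..x, f y = ∫ y in a..b, f y := by
          rw [intervalIntegral.integral_eq_integral_of_support_subset (hsub hβx),
            intervalIntegral.integral_eq_integral_of_support_subset (hsub hβ)]
      _ = 0 := hzero

end PrimitiveSupport

section TestFunctions

namespace IsTest

variable {φ ψ : ℝ → ℂ}

theorem ofReal {g : ℝ → ℝ} (hsmooth : ContDiff ℝ ∞ g) (hcompact : HasCompactSupport g)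
    (hsupport : tsupport g ⊆ Ioo (0 : ℝ) 1) : IsTest (fun x => (g x : ℂ)) where
  smooth := Complex.ofRealCLM.contDiff.comp hsmooth
  compact := hcompact.comp_left Complex.ofReal_zero
  support := (tsupport_comp_subset Complex.ofReal_zero g).trans hsupport

theorem sub (hφ : IsTest φ) (hψ : IsTest ψ) : IsTest (fun x => φ x - ψ x) where
  smooth := hφ.smooth.sub hψ.smooth
  compact := hφ.compact.sub hψ.compact
  support := (tsupport_sub φ ψ).trans (union_subset hφ.support hψ.support)

theorem const_mul (c : ℂ) (hφ : IsTest φ) : IsTest (fun x => c * φ x) where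
  smooth := contDiff_const.mul hφ.smooth
  compact := hφ.compact.mul_left
  support := (tsupport_mul_subset_right (f := fun _ => c)).trans hφ.support

theorem conj (hφ : IsTest φ) : IsTest (fun x => starRingEnd ℂ (φ x)) where
  smooth := Complex.conjCLE.contDiff.comp hφ.smooth
  compact := hφ.compact.comp_left (map_zero _)
  support := (tsupport_comp_subset (map_zero (starRingEnd ℂ)) φ).trans hφ.support

theorem differentiable (hφ : IsTest φ) : Differentiable ℝ φ :=
  hφ.smooth.differentiable (by simp)

theorem intervalIntegrable (hφ : IsTest φ) (a b : ℝ) : IntervalIntegrable φ volume a b :=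
  hφ.smooth.continuous.intervalIntegrable a b

theorem deriv (hφ : IsTest φ) : IsTest (deriv φ) where
  smooth := (contDiff_infty_iff_deriv.1 hφ.smooth).2
  compact := hφ.compact.deriv
  support := (closure_minimal support_deriv_subset isClosed_closure).trans hφ.support

theorem deriv_conj (hφ : IsTest φ) :
    _root_.deriv (fun x => starRingEnd ℂ (φ x)) = fun x => starRingEnd ℂ (_root_.deriv φ x) :=
  funext fun x =>
    (Complex.conjCLE.hasFDerivAt.comp_hasDerivAt x (hφ.differentiable x).hasDerivAt).deriv

theorem eq_zero_of_notMem (hφ : IsTest φ) {x : ℝ} (hx : x ∉ Ioo (0 : ℝ) 1) : φ x = 0 :=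
  image_eq_zero_of_notMem_tsupport fun hmem => hx (hφ.support hmem)

theorem exists_tsupport_subset_Icc (hφ : IsTest φ) :
    ∃ α β : ℝ, 0 < α ∧ β < 1 ∧ tsupport φ ⊆ Icc α β := by
  -- The point `1/2` only makes the compact set nonempty.
  have hK : IsCompact (insert (1 / 2) (tsupport φ)) := hφ.compact.isCompact.insert _
  have hKsub : insert (1 / 2) (tsupport φ) ⊆ Ioo (0 : ℝ) 1 :=
    insert_subset (by norm_num) hφ.support
  obtain ⟨α, hα, hα_le⟩ := hK.exists_isLeast (insert_nonempty _ _)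
  obtain ⟨β, hβ, hle_β⟩ := hK.exists_isGreatest (insert_nonempty _ _)
  exact ⟨α, β, (hKsub hα).1, (hKsub hβ).2,
    fun x hx => ⟨hα_le (mem_insert_of_mem _ hx), hle_β (mem_insert_of_mem _ hx)⟩⟩

theorem exists_deriv_eq (hφ : IsTest φ) (hzero : ∫ y in (0 : ℝ)..1, φ y = 0) :
    ∃ Φ : ℝ → ℂ, IsTest Φ ∧ _root_.deriv Φ = φ := by
  have hderiv (x : ℝ) : HasDerivAt (fun x => ∫ y in (0 : ℝ)..x, φ y) (φ x) x :=
    (hφ.smooth.continuous.integral_hasStrictDerivAt 0 x).hasDerivAt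
  have hderiv_eq : _root_.deriv (fun x => ∫ y in (0 : ℝ)..x, φ y) = φ :=
    funext fun x => (hderiv x).deriv
  obtain ⟨α, β, hα, hβ, hφsub⟩ := hφ.exists_tsupport_subset_Icc
  have hsub : tsupport (fun x => ∫ y in (0 : ℝ)..x, φ y) ⊆ Icc α β :=
    closure_minimal
      (support_primitive_subset_Icc hα hβ ((subset_tsupport φ).trans hφsub) hzero) isClosed_Icc
  refine ⟨_, ⟨contDiff_infty_iff_deriv.2 ⟨fun x => (hderiv x).differentiableAt, ?_⟩, ?_, ?_⟩,
    hderiv_eq⟩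
  · exact hderiv_eq.symm ▸ hφ.smooth
  · exact isCompact_Icc.of_isClosed_subset isClosed_closure hsub
  · exact hsub.trans (Icc_subset_Ioo hα hβ)

theorem memLp (hφ : IsTest φ) : MemLp φ 2 mu :=
  hφ.smooth.continuous.memLp_of_hasCompactSupport hφ.compact

/-- The class in `L²(0,1)` of a test function. -/
def toL2 (hφ : IsTest φ) : L2 := hφ.memLp.toLp φ

theorem coeFn_toL2 (hφ : IsTest φ) : hφ.toL2 =ᵐ[mu] φ := hφ.memLp.coeFn_toLp

theorem inner_toL2_left (hφ : IsTest φ) (f : L2) :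
    ⟪hφ.toL2, f⟫_ℂ = ∫ x, f x * starRingEnd ℂ (φ x) ∂mu := by
  rw [L2.inner_def]
  refine integral_congr_ae ?_
  filter_upwards [hφ.coeFn_toL2] with x hx
  rw [hx, RCLike.inner_apply]

theorem inner_indicatorIoc_one_toL2 (hφ : IsTest φ) :
    ⟪indicatorIoc 1, hφ.toL2⟫_ℂ = ∫ y in (0 : ℝ)..1, φ y := by
  have hone : (1 : ℝ) ∈ Icc (0 : ℝ) 1 := right_mem_Icc.2 zero_le_one
  rw [inner_indicatorIoc _ hone, intervalIntegral_congr_mu hφ.coeFn_toL2 hone]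

theorem hasH10Deriv (hφ : IsTest φ) : HasH10Deriv hφ.toL2 hφ.deriv.toL2 := by
  have hftc : ∀ x ∈ Icc (0 : ℝ) 1, ∫ y in (0 : ℝ)..x, hφ.deriv.toL2 y = φ x := fun x hx => by
    rw [intervalIntegral_congr_mu hφ.deriv.coeFn_toL2 hx,
      intervalIntegral.integral_deriv_eq_sub (fun y _ => hφ.differentiable y)
        (hφ.deriv.intervalIntegrable 0 x), hφ.eq_zero_of_notMem left_notMem_Ioo, sub_zero]
  constructor
  · filter_upwards [hφ.coeFn_toL2, ae_mu_mem_Icc] with x hx hmem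
    rw [hx, hftc x hmem]
  · rw [hftc 1 (right_mem_Icc.2 zero_le_one), hφ.eq_zero_of_notMem right_notMem_Ioo]

end IsTest

theorem exists_isTest_integral_eq_one :
    ∃ ρ : ℝ → ℂ, IsTest ρ ∧ ∫ y in (0 : ℝ)..1, ρ y = 1 := by
  let f : ContDiffBump (1 / 2 : ℝ) := ⟨1 / 8, 1 / 4, by norm_num, by norm_num⟩
  have hsupport : tsupport (f.normed volume) ⊆ Ioo (0 : ℝ) 1 := by
    rw [f.tsupport_normed_eq, Real.closedBall_eq_Icc]
    exact Icc_subset_Ioo (by norm_num [f]) (by norm_num [f])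
  refine ⟨_, .ofReal f.contDiff_normed f.hasCompactSupport_normed hsupport, ?_⟩
  rw [intervalIntegral.integral_ofReal, intervalIntegral.integral_eq_integral_of_support_subset
      ((subset_tsupport _).trans (hsupport.trans Ioo_subset_Ioc_self)),
    f.integral_normed, Complex.ofReal_one]

theorem eq_zero_of_forall_inner_isTest_eq_zero {s : L2}
    (h : ∀ (φ : ℝ → ℂ) (hφ : IsTest φ), ⟪hφ.toL2, s⟫_ℂ = 0) : s = 0 := by
  have hs : LocallyIntegrableOn s (Ioo (0 : ℝ) 1) volume :=
    IntegrableOn.locallyIntegrableOn ((Lp.memLp s).integrable one_le_two)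
  have hae := isOpen_Ioo.ae_eq_zero_of_integral_contDiff_smul_eq_zero hs
    fun g hsmooth hcompact hsupport => by
      have hg := h _ (.ofReal hsmooth hcompact hsupport)
      rw [IsTest.inner_toL2_left] at hg
      rw [← hg, ← setIntegral_eq_integral_of_forall_compl_eq_zero (s := Ioo (0 : ℝ) 1)]
      · simp only [Complex.conj_ofReal, Complex.real_smul, mul_comm]
      · intro x hx
        rw [image_eq_zero_of_notMem_tsupport fun hmem => hx (hsupport hmem), zero_smul]
  exact (Lp.eq_zero_iff_ae_eq_zero).2 ((ae_restrict_iff' measurableSet_Ioo).2 hae)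

/-- Lemma of du Bois-Reymond. A test function minus its mean times a fixed test function of mean `1`
is the derivative of a test function. -/
theorem exists_eq_smul_indicatorIoc_one_of_forall_inner_deriv_eq_zero {s : L2}
    (h : ∀ (φ : ℝ → ℂ) (hφ : IsTest φ), ⟪hφ.deriv.toL2, s⟫_ℂ = 0) :
    ∃ c : ℂ, s = c • indicatorIoc 1 := by
  obtain ⟨ρ, hρ, hρ_mean⟩ := exists_isTest_integral_eq_one
  have hmean_zero {ψ : ℝ → ℂ} (hψ : IsTest ψ) (hψ0 : ∫ y in (0 : ℝ)..1, ψ y = 0) :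
      ⟪hψ.toL2, s⟫_ℂ = 0 := by
    obtain ⟨Ψ, hΨ, rfl⟩ := hψ.exists_deriv_eq hψ0
    exact h Ψ hΨ
  refine ⟨⟪hρ.toL2, s⟫_ℂ, sub_eq_zero.1 (eq_zero_of_forall_inner_isTest_eq_zero fun φ hφ => ?_)⟩
  set m := ∫ y in (0 : ℝ)..1, φ y
  have hψ0 : ∫ y in (0 : ℝ)..1, (φ y - m * ρ y) = 0 := by
    rw [intervalIntegral.integral_sub (hφ.intervalIntegrable 0 1)
      ((hρ.intervalIntegrable 0 1).const_mul m), intervalIntegral.integral_const_mul, hρ_mean,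
      mul_one, sub_self]
  have hψ : ⟪hφ.toL2 - m • hρ.toL2, s⟫_ℂ = 0 := hmean_zero (hφ.sub (hρ.const_mul m)) hψ0
  have hφ_mean : ⟪hφ.toL2, indicatorIoc 1⟫_ℂ = starRingEnd ℂ m := by
    rw [← inner_conj_symm, hφ.inner_indicatorIoc_one_toL2]
  rw [inner_sub_right, inner_smul_right, hφ_mean, mul_comm, ← inner_smul_left, ← inner_sub_left, hψ]

theorem HasH10Deriv.inner_add_inner_eq_zero {f g p r : L2} (hfg : HasH10Deriv f g)
    (h : ∀ (φ : ℝ → ℂ) (hφ : IsTest φ), ⟪hφ.toL2, p⟫_ℂ + ⟪hφ.deriv.toL2, r⟫_ℂ = 0) :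
    ⟪f, p⟫_ℂ + ⟪g, r⟫_ℂ = 0 := by
  have hadjoint {f g : L2} (hfg : HasH10Deriv f g) :
      ⟪f, p⟫_ℂ + ⟪g, r⟫_ℂ = ⟪g, ContinuousLinearMap.adjoint primitive p + r⟫_ℂ := by
    rw [inner_add_right, ContinuousLinearMap.adjoint_inner_right, ← (hasH10Deriv_iff.1 hfg).1]
  obtain ⟨c, hc⟩ := exists_eq_smul_indicatorIoc_one_of_forall_inner_deriv_eq_zero fun φ hφ =>
    (hadjoint hφ.hasH10Deriv).symm.trans (h φ hφ)
  rw [hadjoint hfg, hc, inner_smul_right, ← inner_conj_symm, (hasH10Deriv_iff.1 hfg).2, map_zero,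
    mul_zero]

end TestFunctions

section Solutions

theorem sturmLiouvilleBoundedBelow_iff {q : Linfty} {Λ : ℝ} : SturmLiouvilleBoundedBelow q Λ ↔
    ∀ f g : L2, HasH10Deriv f g → -Λ * ‖f‖ ^ 2 ≤ ‖g‖ ^ 2 + ⟪f, mulOp q f⟫_ℝ := by
  simp only [SturmLiouvilleBoundedBelow, inner_mulOp_self, norm_sq_eq_integral_norm_sq]

theorem SturmLiouvilleBoundedBelow.add_nonneg {q a : Linfty} {Λ : ℝ}
    (hq : SturmLiouvilleBoundedBelow q Λ) (ha : 0 ≤ a) :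
    SturmLiouvilleBoundedBelow (q + a) Λ := by
  rw [sturmLiouvilleBoundedBelow_iff] at hq ⊢
  intro f g hfg
  rw [map_add, add_apply, inner_add_right, ← add_assoc]
  exact le_add_of_le_of_nonneg (hq f g hfg) (inner_mulOp_self_nonneg ha f)

theorem SturmLiouvilleBoundedBelow.of_norm_sub_le {q q' : Linfty} {Λ δ : ℝ}
    (hq : SturmLiouvilleBoundedBelow q Λ) (hδ : ‖q - q'‖ ≤ δ) :
    SturmLiouvilleBoundedBelow q' (Λ + δ) := by
  rw [sturmLiouvilleBoundedBelow_iff] at hq ⊢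
  intro f g hfg
  have hδf := mul_le_mul_of_nonneg_right hδ (sq_nonneg ‖f‖)
  linarith [hq f g hfg, inner_mulOp_self_le_add q q' f]

theorem IsTest.integral_mul_mul_conj {φ : ℝ → ℂ} (hφ : IsTest φ) (c : Linfty) (f : L2) :
    ∫ x, (c x : ℂ) * f x * starRingEnd ℂ (φ x) ∂mu = ⟪hφ.toL2, mulOp c f⟫_ℂ := by
  rw [hφ.inner_toL2_left]
  refine integral_congr_ae ?_
  filter_upwards [coeFn_mulOp c f] with x hx
  rw [hx, Complex.real_smul]

variable {T : ℝ} {a b q a' b' q' : Linfty} {u₀ u₁ u₀' u₁' : L2} {u u' : ℝ → L2}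

theorem inner_toL2_integrated_eq {ut ux : ℝ → L2} (hux : ContinuousOn ux (Icc 0 T))
    (hut : ∀ t ∈ Icc (0 : ℝ) T, HasDerivWithinAt u (ut t) (Icc 0 T) t) {φ : ℝ → ℂ} (hφ : IsTest φ)
    (hweak : ∀ t ∈ Icc (0 : ℝ) T,
      HasDerivWithinAt (fun s => ∫ x, ut s x * starRingEnd ℂ (φ x) ∂mu)
        (-((∫ x, ux t x * deriv (fun x => starRingEnd ℂ (φ x)) x ∂mu)
          + (∫ x, (q x : ℂ) * u t x * starRingEnd ℂ (φ x) ∂mu)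
          + (∫ x, (a x : ℂ) * u t x * starRingEnd ℂ (φ x) ∂mu)
          + ∫ x, (b x : ℂ) * ut t x * starRingEnd ℂ (φ x) ∂mu)) (Icc 0 T) t) :
    ∀ t ∈ Icc (0 : ℝ) T,
      ⟪hφ.toL2, ut t + mulOp b (u t) + mulOp (q + a) (∫ s in (0 : ℝ)..t, u s)
        - (ut 0 + mulOp b (u 0))⟫_ℂ + ⟪hφ.deriv.toL2, ∫ s in (0 : ℝ)..t, ux s⟫_ℂ = 0 := by
  have hu : ContinuousOn u (Icc 0 T) := fun t ht => (hut t ht).continuousWithinAt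
  have inner_right (p : L2) {v : ℝ → L2} {v' : L2} {t : ℝ}
      (hv : HasDerivWithinAt v v' (Icc 0 T) t) :
      HasDerivWithinAt (fun s => ⟪p, v s⟫_ℂ) ⟪p, v'⟫_ℂ (Icc 0 T) t :=
    ((innerSL ℂ p).restrictScalars ℝ).hasFDerivAt.comp_hasDerivWithinAt t hv
  have mulOp_right (c : Linfty) {v : ℝ → L2} {v' : L2} {t : ℝ}
      (hv : HasDerivWithinAt v v' (Icc 0 T) t) :
      HasDerivWithinAt (fun s => mulOp c (v s)) (mulOp c v') (Icc 0 T) t :=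
    (mulOp c).hasFDerivAt.comp_hasDerivWithinAt t hv
  have hderiv (t : ℝ) (ht : t ∈ Icc 0 T) : HasDerivWithinAt (fun t => ⟪hφ.toL2, ut t⟫_ℂ
      + ⟪hφ.toL2, mulOp b (u t)⟫_ℂ + ⟪hφ.toL2, mulOp (q + a) (∫ s in (0 : ℝ)..t, u s)⟫_ℂ
      + ⟪hφ.deriv.toL2, ∫ s in (0 : ℝ)..t, ux s⟫_ℂ) 0 (Icc 0 T) t := by
    have hut_weak := hweak t ht
    simp only [hφ.integral_mul_mul_conj, hφ.deriv_conj, ← hφ.inner_toL2_left,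
      ← hφ.deriv.inner_toL2_left] at hut_weak
    have hdamping := inner_right hφ.toL2 (mulOp_right b (hut t ht))
    have hpotential := inner_right hφ.toL2
      (mulOp_right (q + a) (hasDerivWithinAt_intervalIntegral_Icc hu ht))
    have hux_int := inner_right hφ.deriv.toL2 (hasDerivWithinAt_intervalIntegral_Icc hux ht)
    refine (((hut_weak.add hdamping).add hpotential).add hux_int).congr_deriv ?_
    simp only [map_add, add_apply, inner_add_right]
    ring
  intro t ht
  have hconst := constant_of_has_deriv_right_zero
    (fun t ht => (hderiv t ht).continuousWithinAt)
    (fun t ht => (hderiv t (Ico_subset_Icc_self ht)).mono_of_mem_nhdsWithin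
      (Icc_mem_nhdsGE_of_mem ht)) t ht
  simp only [intervalIntegral.integral_same, map_zero, inner_zero_right, add_zero] at hconst
  simp only [inner_sub_right, inner_add_right]
  linear_combination hconst

theorem IsSolution.exists_isIntegratedSolution (h : IsSolution T a b q u₀ u₁ u) :
    u 0 = u₀ ∧ ∃ ut ux : ℝ → L2, IsIntegratedSolution h10Graph T (mulOp b) (mulOp (q + a))
      (fun _ => u₁ + mulOp b u₀) u ut ux := by
  obtain ⟨ut, ux, hmem, hux, hut, -, rfl, rfl, hweak⟩ := h
  refine ⟨rfl, ut, ux, fun t ht => mem_h10Graph.2 (hmem t ht), hut, hux, fun t ht p hp => ?_⟩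
  have htest := (mem_h10Graph.1 hp).inner_add_inner_eq_zero fun φ hφ =>
    inner_toL2_integrated_eq hux hut hφ (hweak _ hφ.conj) t ht
  rw [real_inner_eq_re_inner, real_inner_eq_re_inner, ← Complex.add_re, htest, Complex.zero_re]

theorem IsSolution.norm_le {Λ β : ℝ} (h : IsSolution T a b q u₀ u₁ u)
    (hqa : SturmLiouvilleBoundedBelow (q + a) Λ)
    (hb : ∀ f : L2, -β * ‖f‖ ^ 2 ≤ ⟪f, mulOp b f⟫_ℝ) :
    ∀ t ∈ Icc (0 : ℝ) T, ‖u t‖ ≤ Real.exp ((|Λ| + 2 * |β| + 2) * T)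
      * (‖u₀‖ + (‖u₁‖ + ‖b‖ * ‖u₀‖)) := by
  obtain ⟨rfl, ut, ux, hint⟩ := h.exists_isIntegratedSolution
  refine hint.norm_le isClosed_h10Graph (inner_mulOp_left (q + a))
    (fun p hp => sturmLiouvilleBoundedBelow_iff.1 hqa p.1 p.2 (mem_h10Graph.1 hp)) hb
    fun t _ => (norm_add_le _ _).trans ?_
  gcongr
  exact norm_mulOp_apply_le b (u 0)

theorem IsSolution.norm_sub_le {Λ β M : ℝ} (h : IsSolution T a b q u₀ u₁ u)
    (h' : IsSolution T a' b' q' u₀' u₁' u') (hqa : SturmLiouvilleBoundedBelow (q + a) Λ)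
    (hb : ∀ f : L2, -β * ‖f‖ ^ 2 ≤ ⟪f, mulOp b f⟫_ℝ) (hM : ∀ t ∈ Icc (0 : ℝ) T, ‖u' t‖ ≤ M) :
    ∀ t ∈ Icc (0 : ℝ) T, ‖u t - u' t‖ ≤ Real.exp ((|Λ| + 2 * |β| + 2) * T)
      * (‖u₀ - u₀'‖ + (‖u₁ - u₁'‖ + (‖b‖ * ‖u₀ - u₀'‖ + ‖u₀'‖ * ‖b - b'‖)
        + M * (T * ‖q + a - (q' + a')‖ + ‖b - b'‖))) := by
  obtain ⟨rfl, ut, ux, hint⟩ := h.exists_isIntegratedSolution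
  obtain ⟨rfl, ut', ux', hint'⟩ := h'.exists_isIntegratedSolution
  have hdata : ‖u₁ + mulOp b (u 0) - (u₁' + mulOp b' (u' 0))‖
      ≤ ‖u₁ - u₁'‖ + (‖b‖ * ‖u 0 - u' 0‖ + ‖u' 0‖ * ‖b - b'‖) := by
    have hsplit : u₁ + mulOp b (u 0) - (u₁' + mulOp b' (u' 0))
        = u₁ - u₁' + (mulOp b (u 0 - u' 0) + mulOp (b - b') (u' 0)) := by
      simp only [map_sub, sub_apply]
      abel
    rw [hsplit, mul_comm ‖u' 0‖]
    exact norm_add_le_of_le le_rfl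
      (norm_add_le_of_le (norm_mulOp_apply_le _ _) (norm_mulOp_apply_le _ _))
  intro t ht
  have hT : 0 ≤ T := ht.1.trans ht.2
  have hM0 : 0 ≤ M := (norm_nonneg _).trans (hM t ht)
  refine (hint.norm_sub_le isClosed_h10Graph (inner_mulOp_left (q + a))
    (fun p hp => sturmLiouvilleBoundedBelow_iff.1 hqa p.1 p.2 (mem_h10Graph.1 hp)) hb hint'
    (fun _ _ => hdata) hM t ht).trans ?_
  rw [← map_sub, ← map_sub]
  gcongr <;> exact norm_mulOp_le _

end Solutions

end

end VeryWeakWave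

open scoped InnerProductSpace in
theorem mainTheorem8_general (T : ℝ) {a a' b b' q q' : ℝ → Linfty} {u₀ u₀' u₁ u₁' : ℝ → L2}
    (hqa_below : ∃ Λ : ℝ, ∀ ε ∈ Ioc (0 : ℝ) 1, SturmLiouvilleBoundedBelow (q ε + a ε) Λ)
    (hb_below : ∃ β : ℝ, ∀ ε ∈ Ioc (0 : ℝ) 1, ∀ᵐ x ∂mu, -β ≤ b ε x)
    (hb : Moderate b) (hu₀ : Moderate u₀) (hu₁ : Moderate u₁)
    (hqa_sub : Negligible (fun ε => q ε + a ε - (q' ε + a' ε)))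
    (hb_sub : Negligible (fun ε => b ε - b' ε))
    (hu₀_sub : Negligible (fun ε => u₀ ε - u₀' ε))
    (hu₁_sub : Negligible (fun ε => u₁ ε - u₁' ε)) {u u' : ℝ → ℝ → L2}
    (hu : ∀ ε ∈ Ioc (0 : ℝ) 1, IsSolution T (a ε) (b ε) (q ε) (u₀ ε) (u₁ ε) (u ε))
    (hu' : ∀ ε ∈ Ioc (0 : ℝ) 1, IsSolution T (a' ε) (b' ε) (q' ε) (u₀' ε) (u₁' ε) (u' ε)) :
    L2NegligibleOn T (fun ε t => u ε t - u' ε t) := by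
  obtain ⟨Λ, hΛ⟩ := hqa_below
  obtain ⟨β, hβ⟩ := hb_below
  obtain ⟨δ, hδ⟩ : ∃ δ, ∀ ε ∈ Ioc (0 : ℝ) 1, ‖q ε + a ε - (q' ε + a' ε)‖ ≤ δ := by
    simpa using hqa_sub 0
  obtain ⟨η, hη⟩ : ∃ η, ∀ ε ∈ Ioc (0 : ℝ) 1, ‖b ε - b' ε‖ ≤ η := by simpa using hb_sub 0
  have hb_form (ε : ℝ) (hε : ε ∈ Ioc 0 1) (f : L2) :
      -β * ‖f‖ ^ 2 ≤ ⟪f, mulOp (b ε) f⟫_ℝ :=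
    neg_mul_norm_sq_le_inner_mulOp_self (hβ ε hε) f
  have hb'_form (ε : ℝ) (hε : ε ∈ Ioc 0 1) (f : L2) :
      -(β + η) * ‖f‖ ^ 2 ≤ ⟪f, mulOp (b' ε) f⟫_ℝ := by
    linarith [hb_form ε hε f, inner_mulOp_self_le_add (b ε) (b' ε) f,
      mul_le_mul_of_nonneg_right (hη ε hε) (sq_nonneg ‖f‖)]
  have hb' : Moderate b' := by simpa using hb.add hb_sub.sub_rev.moderate
  have hbound : Moderate (fun ε => Real.exp ((|Λ| + 2 * |β| + 2) * T)
      * (‖u₀ ε‖ + (‖u₁ ε‖ + ‖b ε‖ * ‖u₀ ε‖))) :=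
    (moderate_const _).mul (hu₀.norm.add (hu₁.norm.add (hb.norm.mul hu₀.norm)))
  have hsource := hu₁_sub.sub_rev.norm.add
    ((hb'.norm.mul_negligible hu₀_sub.sub_rev.norm).add
      (hu₀.norm.mul_negligible hb_sub.sub_rev.norm)) |>.add
    (hbound.mul_negligible (((moderate_const T).mul_negligible hqa_sub.sub_rev.norm).add
      hb_sub.sub_rev.norm))
  have hnegl := (moderate_const (Real.exp ((|Λ + δ| + 2 * |β + η| + 2) * T))).mul_negligible
    (hu₀_sub.sub_rev.norm.add hsource)
  refine fun k => (hnegl k).imp fun C hC ε hε t ht => ?_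
  rw [norm_sub_rev]
  exact ((hu' ε hε).norm_sub_le (hu ε hε) ((hΛ ε hε).of_norm_sub_le (hδ ε hε)) (hb'_form ε hε)
    ((hu ε hε).norm_le (hΛ ε hε) (hb_form ε hε)) t ht).trans ((le_abs_self _).trans (hC ε hε))

theorem mainTheorem8 (T : ℝ) (hT : 0 < T)
    -- two nets of coefficients
    (a a' b b' q q' : ℝ → Linfty)
    (ha_nonneg : ∀ ε ∈ Ioc (0 : ℝ) 1, 0 ≤ a ε) (ha'_nonneg : ∀ ε ∈ Ioc (0 : ℝ) 1, 0 ≤ a' ε)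
    (hb_nonneg : ∀ ε ∈ Ioc (0 : ℝ) 1, 0 ≤ b ε) (hb'_nonneg : ∀ ε ∈ Ioc (0 : ℝ) 1, 0 ≤ b' ε)
    (ha : Moderate a) (ha' : Moderate a') (hb : Moderate b) (hb' : Moderate b')
    (hq : Moderate q) (hq' : Moderate q')
    -- the operators `L_{q_ε}` are bounded below uniformly in `ε`
    (hq_below : ∃ Λ : ℝ, ∀ ε ∈ Ioc (0 : ℝ) 1, SturmLiouvilleBoundedBelow (q ε) Λ)
    -- two nets of initial data
    (u₀ u₀' u₁ u₁' : ℝ → L2)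
    (hu₀ : H2Moderate u₀) (hu₀' : H2Moderate u₀') (hu₁ : Moderate u₁) (hu₁' : Moderate u₁')
    -- the two nets differ by negligible nets
    (haa' : Negligible (fun ε => a ε - a' ε)) (hbb' : Negligible (fun ε => b ε - b' ε))
    (hqq' : Negligible (fun ε => q ε - q' ε))
    (hu₀u₀' : H2Negligible (fun ε => u₀ ε - u₀' ε))
    (hu₁u₁' : Negligible (fun ε => u₁ ε - u₁' ε))
    -- the solution nets of the regularised problems
    (u u' : ℝ → ℝ → L2)
    (hu : ∀ ε ∈ Ioc (0 : ℝ) 1, IsSolution T (a ε) (b ε) (q ε) (u₀ ε) (u₁ ε) (u ε))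
    (hu' : ∀ ε ∈ Ioc (0 : ℝ) 1, IsSolution T (a' ε) (b' ε) (q' ε) (u₀' ε) (u₁' ε) (u' ε)) :
    L2NegligibleOn T (fun ε t => u ε t - u' ε t) := by
  obtain ⟨Λ, hΛ⟩ := hq_below
  refine mainTheorem8_general T
    ⟨Λ, fun ε hε => (hΛ ε hε).add_nonneg (ha_nonneg ε hε)⟩
    ⟨0, fun ε hε =>
      ((Lp.coeFn_nonneg (b ε)).2 (hb_nonneg ε hε)).mono fun _ hx => neg_zero.trans_le hx⟩
    hb hu₀.moderate hu₁ ?_ hbb' hu₀u₀'.negligible hu₁u₁' hu hu'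
  simpa only [add_sub_add_comm] using hqq'.add haa'
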